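/- **Setting.** Let $G=(V,E)$ be a finite graph, $v\in V$, $w:V\to\mathbb{R}$ and $A\subseteq \mathrm{Aut}(G)$. For a coloring $\varphi:V\to\{\bullet,\circ\}$ (black, white) put $A_\bullet=\{\xi\in A\mid \varphi(\xi(v))=\bullet\}$ and $A_\circ=\{\xi\in A\mid \varphi(\xi(v))=\circ\}$, and for $\xi\in A$ put $S(\xi)=\sum_{u\in V,\ \varphi(\xi(u))=\bullet}w(u)$. The coloring $\varphi$ is a *constant $2$-labelling* if $S$ is constant on $A_\bullet$ and constant on $A_\circ$; it is *trivial* if $\varphi$ is monochromatic. When $A_\bullet$ and $A_\circ$ are non-empty, the constants of $\varphi$ are $a=S(\xi)$ for $\xi\in A_\bullet$ and $b=S(\xi')$ for $\xi'\in A_\circ$. Let $p\ge 2$, and let $\mathcal{C}_p$ be the cycle on the vertices $0,\dots,p-1$ with real weights $w(0),\dots,w(p-1)$, written as the word $w(0)\cdots w(p-1)$. Take $v=0$ and $A=\{\mathcal{R}_k\mid k\in\mathbb{Z}\}$, where $\mathcal{R}_k(i)=i+k \bmod p$. For $x,y,z,t\in\mathbb{R}$ the cycle is of one of the Types 1–8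 if its word is, respectively (the exponents must be non-negative integers), 1. $zx^{p-1}$; 2. $zx^{\frac{p-2}{2}}tx^{\frac{p-2}{2}}$, with $x\ne t$; 3. $z(xy)^{\frac{p-1}{2}}$, with $x\ne y$; 4. $z(xy)^{\frac{p-2}{2}}x$, with $x\ne y$; 5. $z(xy)^{\frac{p-1}{4}}(yx)^{\frac{p-1}{4}}$, with $x\ne y$; 6. $z(xy)^{\frac{p-3}{4}}xx(yx)^{\frac{p-3}{4}}$, with $x\ne y$; 7. $z(xy)^{\frac{p-2}{4}}t(yx)^{\frac{p-2}{4}}$, with $x\ne y$ and $t\ne x$; 8. $z(xy)^{\frac{p-4}{4}}xtx(yx)^{\frac{p-4}{4}}$, with $x\ne y$ and $y\ne t$. **Theorem.** Let $\varphi$ be a non-trivial constant $2$-labelling of a weighted cycle $\mathcal{C}_p$ of one of the Types 1–8. Then $A_\bullet$ and $A_\circ$ are non-empty, and the constants $a$ and $b$ of $\varphi$ take one of the following pairs of values, according to the type ($\alpha$ denotes an integer): * Type 1: $a=\alpha x+z$, $b=(\alpha+1)x$ with $0\le\alpha\le p-2$. * Type 2: $a=2\alpha x+t+z$, $b=2(\alpha+1)x$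 with $0\le\alpha\le\frac{p-4}{2}$; or $a=(\frac p2-1)x+z$, $b=(\frac p2-1)x+t$. * Type 3: no value is possible, i.e. there is no non-trivial constant $2$-labelling. * Type 4: $a=(\alpha+1)x+\alpha y+z$, $b=(\alpha+1)(x+y)$ with $0\le\alpha\le\frac{p-4}{2}$; or $a=(\frac p2-1)y+z$, $b=\frac p2x$. * Type 5: $p\equiv0\pmod 3$, and either $a=\frac p3x+(\frac p3-1)y+z$, $b=(\frac p3-1)x+(\frac p3+1)y$, or (complementary coloring) $a=\frac{p+3}{6}x+\frac{p-9}{6}y+z$, $b=\frac{p-3}{6}x+\frac{p+3}{6}y$. * Type 6: $p\equiv0\pmod 3$, and either $a=\frac p3x+(\frac p3-1)y+z$, $b=(\frac p3+1)x+(\frac p3-1)y$, or (complementary coloring) $a=\frac{p-3}{6}(x+y)+z$, $b=\frac{p+3}{6}x+\frac{p-3}{6}y$. * Type 7: $a=(\frac p2-1)y+z$, $b=(\frac p2-1)x+t$; or $a=\alpha(x+y)+t+z$, $b=(\alpha+1)(x+y)$ with $0\le\alpha\le\frac p2-1$. * Type 8: one of * $a=(\frac p2-2)y+z+t$, $b=\frac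 p2x$; * $a=(2\alpha+2)x+2\alpha y+z+t$, $b=(2\alpha+2)(x+y)$ with $0\le\alpha\le\frac p4-1$; * $a=\frac p4x+(\frac p4-1)y+z$, $b=\frac p4x+(\frac p4-1)y+t$; * $t=\frac p4x+(1-\frac p4)y$, $a=\frac p2x+(\frac p4-1)y+z$, $b=\frac{3p}{4}x$; * $t=\frac p4x+(1-\frac p4)y$, $a=(\frac p4-1)y+z$, $b=\frac p4x$. -/

import Mathlib

/-- The two colours `•` (black) and `∘` (white). -/
inductive Color where
  | black
  | white
  deriving DecidableEq

section General

variable {V : Type*}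

/-- The automorphisms `ξ ∈ A` such that `φ ∘ ξ` gives the colour `c` to the vertex `v`. For
`c = black` and `c = white` these are the sets `A_•` and `A_∘`. -/
def autsWithColor (G : SimpleGraph V) (v : V) (A : Set (G ≃g G)) (φ : V → Color) (c : Color) :
    Set (G ≃g G) :=
  {ξ | ξ ∈ A ∧ φ (ξ v) = c}

/-- The sum of the weights of the vertices that are black in the coloring `φ ∘ ξ`. -/
noncomputable def blackWeight [Fintype V] {G : SimpleGraph V} (w : V → ℝ) (φ : V → Color)
    (ξ : G ≃g G) : ℝ :=
  ∑ u : V with φ (ξ u) = Color.black, w u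

/-- `φ` is a constant 2-labelling of the graph `G` with weights `w`, with respect to the vertex
`v` and the set `A` of automorphisms. -/
def IsConstantTwoLabelling [Fintype V] (G : SimpleGraph V) (v : V) (w : V → ℝ)
    (A : Set (G ≃g G)) (φ : V → Color) : Prop :=
  ∀ c : Color, ∀ ξ ∈ autsWithColor G v A φ c, ∀ ξ' ∈ autsWithColor G v A φ c,
    blackWeight w φ ξ = blackWeight w φ ξ'

/-- All vertices have the same colour; the monochromatic colorings are the trivial constant
2-labellings. -/
def IsMonochromatic (φ : V → Color) : Prop :=
  ∃ c : Color, ∀ u : V, φ u = c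

end General

section Rotations

/-- The `k`-rotation `i ↦ i + k mod p` of the cycle on the vertices `0, …, p - 1`. -/
def cycleRotation (p : ℕ) [NeZero p] (k : ℤ) :
    SimpleGraph.cycleGraph p ≃g SimpleGraph.cycleGraph p where
  toEquiv := Equiv.addRight (Fin.intCast k)
  map_rel_iff' := by
    intro a b
    simp [SimpleGraph.cycleGraph_adj']

theorem cycleRotation_val (p : ℕ) [NeZero p] (k : ℤ) (i : Fin p) :
    ((cycleRotation p k i : ℕ) : ℤ) = ((i : ℕ) + k) % (p : ℤ) := by
  have hp : (p : ℤ) ≠ 0 := by exact_mod_cast NeZero.ne p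
  have hk : (((Fin.intCast k : Fin p) : ℕ) : ℤ) = k % p := by
    rw [show ((Fin.intCast k : Fin p) : ℕ) = (k % p).toNat from Fin.val_intCast k]
    exact Int.toNat_of_nonneg (Int.emod_nonneg _ hp)
  change (((i + Fin.intCast k : Fin p) : ℕ) : ℤ) = _
  rw [Fin.val_add]
  push_cast
  rw [hk, Int.add_emod_emod]

/-- The set `{R_k | k ∈ ℤ}` of all rotations. -/
def cycleRotations (p : ℕ) [NeZero p] :
    Set (SimpleGraph.cycleGraph p ≃g SimpleGraph.cycleGraph p) :=
  Set.range (cycleRotation p)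

end Rotations

/-- The eight types of weighted cycles. -/
inductive CycleType where
  | type1 | type2 | type3 | type4 | type5 | type6 | type7 | type8

/-- The word `u ^ k`, i.e. `k` copies of the word `u`. -/
def wordPow (u : List ℝ) (k : ℕ) : List ℝ :=
  (List.replicate k u).flatten

/-- The word of weights of each type; `k` is the exponent that occurs in it. -/
def CycleType.word (x y z t : ℝ) (k : ℕ) : CycleType → List ℝ
  | type1 => [z] ++ wordPow [x] k
  | type2 => [z] ++ wordPow [x] k ++ [t] ++ wordPow [x] k
  | type3 => [z] ++ wordPow [x, y] k
  | type4 => [z] ++ wordPow [x, y] k ++ [x]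
  | type5 => [z] ++ wordPow [x, y] k ++ wordPow [y, x] k
  | type6 => [z] ++ wordPow [x, y] k ++ [x, x] ++ wordPow [y, x] k
  | type7 => [z] ++ wordPow [x, y] k ++ [t] ++ wordPow [y, x] k
  | type8 => [z] ++ wordPow [x, y] k ++ [x, t, x] ++ wordPow [y, x] k

/-- The weights that are required to be distinct in each type. -/
def CycleType.DistinctWeights (x y t : ℝ) : CycleType → Prop
  | type1 => True
  | type2 => x ≠ t
  | type3 => x ≠ y
  | type4 => x ≠ y
  | type5 => x ≠ y
  | type6 => x ≠ y
  | type7 => x ≠ y ∧ t ≠ x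
  | type8 => x ≠ y ∧ y ≠ t

/-- The cycle on `p` vertices with weights `w 0, …, w (p - 1)` is of type `T` with parameters
`x`, `y`, `z`, `t`. As the words have to have the same length, the exponent `k` is determined by
`p`: it is `p - 1`, `(p - 2) / 2`, `(p - 1) / 2`, `(p - 2) / 2`, `(p - 1) / 4`, `(p - 3) / 4`,
`(p - 2) / 4`, `(p - 4) / 4` for the types 1 to 8, and this number must be a natural number. -/
def IsCycleOfType (T : CycleType) {p : ℕ} (w : Fin p → ℝ) (x y z t : ℝ) : Prop :=
  (∃ k : ℕ, List.ofFn w = T.word x y z t k) ∧ T.DistinctWeights x y t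

/-- The table of the possible values of the constants `a` and `b`. -/
def PossibleConstants (p : ℕ) (x y z t a b : ℝ) : CycleType → Prop
  | .type1 => ∃ α : ℕ, α + 2 ≤ p ∧ a = α * x + z ∧ b = (α + 1) * x
  | .type2 =>
      (∃ α : ℕ, 2 * α + 4 ≤ p ∧ a = 2 * α * x + t + z ∧ b = 2 * (α + 1) * x) ∨
      (a = ((p : ℝ) / 2 - 1) * x + z ∧ b = ((p : ℝ) / 2 - 1) * x + t)
  | .type3 => False
  | .type4 =>
      (∃ α : ℕ, 2 * α + 4 ≤ p ∧ a = (α + 1) * x + α * y + z ∧ b = (α + 1) * (x + y)) ∨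
      (a = ((p : ℝ) / 2 - 1) * y + z ∧ b = (p : ℝ) / 2 * x)
  | .type5 =>
      p % 3 = 0 ∧
      ((a = (p : ℝ) / 3 * x + ((p : ℝ) / 3 - 1) * y + z ∧
          b = ((p : ℝ) / 3 - 1) * x + ((p : ℝ) / 3 + 1) * y) ∨
        (a = ((p : ℝ) + 3) / 6 * x + ((p : ℝ) - 9) / 6 * y + z ∧
          b = ((p : ℝ) - 3) / 6 * x + ((p : ℝ) + 3) / 6 * y))
  | .type6 =>
      p % 3 = 0 ∧
      ((a = (p : ℝ) / 3 * x + ((p : ℝ) / 3 - 1) * y + z ∧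
          b = ((p : ℝ) / 3 + 1) * x + ((p : ℝ) / 3 - 1) * y) ∨
        (a = ((p : ℝ) - 3) / 6 * x + ((p : ℝ) - 3) / 6 * y + z ∧
          b = ((p : ℝ) + 3) / 6 * x + ((p : ℝ) - 3) / 6 * y))
  | .type7 =>
      (a = ((p : ℝ) / 2 - 1) * y + z ∧ b = ((p : ℝ) / 2 - 1) * x + t) ∨
      (∃ α : ℕ, 2 * α + 2 ≤ p ∧ a = α * (x + y) + t + z ∧ b = (α + 1) * (x + y))
  | .type8 =>
      (a = ((p : ℝ) / 2 - 2) * y + z + t ∧ b = (p : ℝ) / 2 * x) ∨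
      (∃ α : ℕ, 4 * α + 4 ≤ p ∧ a = (2 * α + 2) * x + 2 * α * y + z + t ∧
        b = (2 * α + 2) * (x + y)) ∨
      (a = (p : ℝ) / 4 * x + ((p : ℝ) / 4 - 1) * y + z ∧
        b = (p : ℝ) / 4 * x + ((p : ℝ) / 4 - 1) * y + t) ∨
      (t = (p : ℝ) / 4 * x + (1 - (p : ℝ) / 4) * y ∧
        a = (p : ℝ) / 2 * x + ((p : ℝ) / 4 - 1) * y + z ∧ b = 3 * (p : ℝ) / 4 * x) ∨
      (t = (p : ℝ) / 4 * x + (1 - (p : ℝ) / 4) * y ∧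
        a = ((p : ℝ) / 4 - 1) * y + z ∧ b = (p : ℝ) / 4 * x)

/-!
Let `g : ℕ → ℝ` be the indicator function of the black vertices, read modulo `p`, and let
`S k = ∑ i, w i * g (k + i)`. The rotation that takes `0` to `k` has black weight `S k`, so that
`φ` is a constant 2-labelling with constants `a` and `b` exactly when `S k = b + (a - b) * g k` for
all `k`. The table is read off from this equation.

* Types 1 and 2: `S k` is a combination of `g k`, the antipodal value `g (k + p / 2)` (type 2 only)
  and the number of black vertices. In type 2, therefore, the colour of a vertex determines that of
  its antipode, and antipodes either always agree or always differ
  (`antipode_eq_or_eq_one_sub`).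
* Types 4, 7 and 8 (`p` even): `S k` is a combination of `g k`, the antipodal value and the numbers
  of black vertices of the parity of `k` and of the other parity. If these two numbers agree, the
  argument for type 2 applies. If they differ, then two neighbours of the same colour, with
  antipodes of the same colour, would have different sums, and the coloring has to alternate
  (`IsBlackIndicator.succ_eq_one_sub_of_alternateSum_ne`). The one exception occurs in type 8, when
  antipodes differ in one parity class and agree in the other. Then the second class is
  monochromatic, and `t` is determined by `x` and `y`.
* Types 3, 5 and 6 (`p` odd): the weights have period 2 away from a few places, so that
  `S (k + 2) - S k` involves only a few values of `g`. In type 3 this gives a linear recurrence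
  between consecutive differences of `g`, which has no nonconstant periodic solution with values in
  `{0, 1}`. In types 5 and 6 it relates `g (k + 2) - g k` to the difference of the values of `g` at
  the two vertices `k + 1 ± 1 / 2`, where `1 / 2` is taken modulo `p`; after the substitution
  `k = j / 2` this forces `3 ∣ p` and that `g` has period 3
  (`IsBlackIndicator.periodic_three_of_local_relation`). It also fixes `a - b`, and the sum of the
  equation over all `k` then yields `b`.
-/

/-! ### Sums along words and along parity classes -/

theorem sum_range_add_left_of_periodic {g : ℕ → ℝ} {m : ℕ} (hg : ∀ k, g (k + m) = g k)
    (s : ℕ) :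
    ∑ i ∈ Finset.range m, g (s + i) = ∑ i ∈ Finset.range m, g i := by
  induction s with
  | zero => simp
  | succ s ih =>
    rw [← ih]
    have h1 := Finset.sum_range_succ (fun i => g (s + i)) m
    have h2 := Finset.sum_range_succ' (fun i => g (s + i)) m
    have h3 : ∑ i ∈ Finset.range m, g (s + 1 + i) = ∑ i ∈ Finset.range m, g (s + (i + 1)) :=
      Finset.sum_congr rfl fun i _ => by congr 1; omega
    rw [h3]
    have := hg s
    simp only [add_zero] at h2
    linarith

/-- The sum `∑ i, L[i] * g (s + i)` over the entries of the word `L`. It is defined by recursion on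
`L`, so that it splits along concatenations. -/
def weightedSum (g : ℕ → ℝ) : List ℝ → ℕ → ℝ
  | [], _ => 0
  | a :: L, s => a * g s + weightedSum g L (s + 1)

theorem weightedSum_append (g : ℕ → ℝ) (L M : List ℝ) (s : ℕ) :
    weightedSum g (L ++ M) s = weightedSum g L s + weightedSum g M (s + L.length) := by
  induction L generalizing s with
  | nil => simp [weightedSum]
  | cons a L ih =>
    simp only [List.cons_append, weightedSum, ih, List.length_cons]
    rw [show s + 1 + L.length = s + (L.length + 1) by omega]
    ring

theorem weightedSum_ofFn (g : ℕ → ℝ) {p : ℕ} (w : Fin p → ℝ) (s : ℕ) :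
    weightedSum g (List.ofFn w) s = ∑ i : Fin p, w i * g (s + i) := by
  induction p generalizing s with
  | zero => simp [weightedSum]
  | succ p ih =>
    simp only [List.ofFn_succ, weightedSum, ih, Fin.sum_univ_succ, Fin.val_zero, Fin.val_succ,
      add_zero]
    congr 1
    refine Finset.sum_congr rfl fun i _ => ?_
    rw [show s + 1 + (i : ℕ) = s + (i + 1) by omega]

/-- The sum of `m` values of `g` at every other point, starting at `s`. -/
def alternateSum (g : ℕ → ℝ) (m s : ℕ) : ℝ := ∑ i ∈ Finset.range m, g (s + 2 * i)

theorem alternateSum_add (g : ℕ → ℝ) (m n s : ℕ) :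
    alternateSum g (m + n) s = alternateSum g m s + alternateSum g n (s + 2 * m) := by
  simp only [alternateSum, Finset.sum_range_add]
  congr 1
  exact Finset.sum_congr rfl fun i _ => by congr 1; ring

theorem alternateSum_one (g : ℕ → ℝ) (s : ℕ) : alternateSum g 1 s = g s := by
  simp [alternateSum]

theorem alternateSum_add_two (g : ℕ → ℝ) (m s : ℕ) :
    alternateSum g m (s + 2) = alternateSum g m s + g (s + 2 * m) - g s := by
  have h1 := alternateSum_add g m 1 s
  have h2 := alternateSum_add g 1 m s
  rw [add_comm 1 m] at h2
  rw [alternateSum_one] at h1 h2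
  rw [mul_one] at h2
  linarith

theorem alternateSum_add_two_of_periodic {g : ℕ → ℝ} {h : ℕ} (hg : ∀ k, g (k + 2 * h) = g k)
    (s : ℕ) : alternateSum g h (s + 2) = alternateSum g h s := by
  rw [alternateSum_add_two, hg]
  ring

theorem alternateSum_add_two_mul_of_periodic {g : ℕ → ℝ} {h : ℕ}
    (hg : ∀ k, g (k + 2 * h) = g k) (s m : ℕ) :
    alternateSum g h (s + 2 * m) = alternateSum g h s := by
  induction m with
  | zero => rfl
  | succ m ih => rw [mul_add, mul_one, ← add_assoc, alternateSum_add_two_of_periodic hg, ih]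

theorem alternateSum_ne_succ_of_periodic {g : ℕ → ℝ} {h : ℕ} (hg : ∀ k, g (k + 2 * h) = g k)
    (hE : alternateSum g h 0 ≠ alternateSum g h 1) (k : ℕ) :
    alternateSum g h k ≠ alternateSum g h (k + 1) := by
  induction k with
  | zero => exact hE
  | succ k ih => rw [alternateSum_add_two_of_periodic hg]; exact ih.symm

theorem sum_alternateSum_of_periodic {g : ℕ → ℝ} {p : ℕ} (hg : ∀ k, g (k + p) = g k) (m s : ℕ) :
    ∑ k ∈ Finset.range p, alternateSum g m (k + s) = m * ∑ k ∈ Finset.range p, g k := by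
  simp only [alternateSum]
  rw [Finset.sum_comm]
  rw [Finset.sum_congr rfl (g := fun _ => ∑ k ∈ Finset.range p, g k)]
  · simp
  · intro i _
    rw [← sum_range_add_left_of_periodic hg (s + 2 * i)]
    exact Finset.sum_congr rfl fun k _ => by congr 1; ring

theorem wordPow_succ (u : List ℝ) (k : ℕ) : wordPow u (k + 1) = u ++ wordPow u k := by
  simp [wordPow, List.replicate_succ]

theorem length_wordPow (u : List ℝ) (k : ℕ) : (wordPow u k).length = k * u.length := by
  simp [wordPow]

theorem weightedSum_wordPow_singleton (g : ℕ → ℝ) (x : ℝ) (k s : ℕ) :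
    weightedSum g (wordPow [x] k) s = x * ∑ i ∈ Finset.range k, g (s + i) := by
  induction k generalizing s with
  | zero => simp [wordPow, weightedSum]
  | succ k ih =>
    rw [wordPow_succ, weightedSum_append, ih, Finset.sum_range_succ']
    simp only [weightedSum, List.length_singleton, add_zero]
    rw [Finset.sum_congr rfl (g := fun i => g (s + (i + 1)))
      (fun i _ => by congr 1; ring)]
    ring

theorem weightedSum_wordPow_pair (g : ℕ → ℝ) (x y : ℝ) (k s : ℕ) :
    weightedSum g (wordPow [x, y] k) s =
      x * alternateSum g k s + y * alternateSum g k (s + 1) := by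
  induction k generalizing s with
  | zero => simp [wordPow, weightedSum, alternateSum]
  | succ k ih =>
    rw [wordPow_succ, weightedSum_append, ih, add_comm k 1, alternateSum_add, alternateSum_add,
      alternateSum_one, alternateSum_one]
    simp only [weightedSum, List.length_cons, List.length_nil]
    rw [show s + 1 + 2 * 1 = s + (0 + 1 + 1) + 1 by ring, show s + 2 * 1 = s + (0 + 1 + 1) by ring]
    ring

/-! ### Indicator functions of colorings -/

/-- `g` is the indicator function of the black vertices of a coloring of the cycle of length `p`
that uses both colours; the vertices are read modulo `p`. -/
structure IsBlackIndicator (p : ℕ) (g : ℕ → ℝ) : Prop where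
  zero_or_one : ∀ k, g k = 0 ∨ g k = 1
  periodic : ∀ k, g (k + p) = g k
  exists_black : ∃ k, g k = 1
  exists_white : ∃ k, g k = 0

open scoped Finset in
/-- The sum of a `{0, 1}`-valued function over a period counts the points where it is `1`; the
count is extreme only for a constant function. -/
theorem exists_nat_sum_eq {q : ℕ → ℝ} (h01 : ∀ k, q k = 0 ∨ q k = 1) {m : ℕ} (hm : 0 < m)
    (hq : ∀ k, q (k + m) = q k) :
    ∃ n : ℕ, n ≤ m ∧ ∑ i ∈ Finset.range m, q i = n ∧ (n = 0 → ∀ i, q i = 0) ∧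
      (n = m → ∀ i, q i = 1) := by
  have hmod : ∀ k, q (k % m) = q k := fun k => Function.Periodic.map_mod_nat hq k
  refine ⟨#{i ∈ Finset.range m | q i = 1}, ?_, ?_, ?_, ?_⟩
  · simpa using Finset.card_filter_le (Finset.range m) (fun i => q i = 1)
  · rw [← Finset.sum_boole]
    refine Finset.sum_congr rfl fun i _ => ?_
    rcases h01 i with h | h <;> simp [h]
  · intro h i
    rw [Finset.card_eq_zero, Finset.filter_eq_empty_iff] at h
    have := h (Finset.mem_range.2 (Nat.mod_lt i hm))
    rw [hmod] at this
    exact (h01 i).resolve_right this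
  · intro h i
    have h' : #{i ∈ Finset.range m | q i = 1} = #(Finset.range m) := by simpa using h
    rw [Finset.card_filter_eq_iff] at h'
    rw [← hmod]
    exact h' _ (Finset.mem_range.2 (Nat.mod_lt i hm))

theorem exists_nat_alternateSum_eq {g : ℕ → ℝ} (h01 : ∀ k, g k = 0 ∨ g k = 1) {m : ℕ}
    (hm : 0 < m) (hg : ∀ k, g (k + 2 * m) = g k) (s : ℕ) :
    ∃ n : ℕ, n ≤ m ∧ alternateSum g m s = n ∧ (n = 0 → ∀ i, g (s + 2 * i) = 0) ∧
      (n = m → ∀ i, g (s + 2 * i) = 1) := by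
  refine exists_nat_sum_eq (q := fun i => g (s + 2 * i)) (fun k => h01 _) hm fun k => ?_
  rw [← hg (s + 2 * k)]
  congr 1
  ring

/-- If the colour of the antipode of a vertex is determined by the colour of that vertex, then
antipodes either always agree or always differ. -/
theorem antipode_eq_or_eq_one_sub {q : ℕ → ℝ} {h : ℕ} (h01 : ∀ k, q k = 0 ∨ q k = 1)
    (hq : ∀ k, q (k + h + h) = q k) (hdep : ∀ k k', q k = q k' → q (k + h) = q (k' + h)) :
    (∀ k, q (k + h) = q k) ∨ ∀ k, q (k + h) = 1 - q k := by
  by_contra! ⟨⟨k, hk⟩, k', hk'⟩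
  have h1 := hdep k' k
  have h2 := hdep k' (k + h)
  rw [hq] at h2
  rcases h01 k with e1 | e1 <;> rcases h01 (k + h) with e2 | e2 <;>
    rcases h01 k' with e3 | e3 <;> rcases h01 (k' + h) with e4 | e4 <;> simp_all

theorem alternateSum_of_antipode_eq {g : ℕ → ℝ} {h s : ℕ}
    (hg : ∀ i, g (s + 2 * (i + h)) = g (s + 2 * i)) :
    alternateSum g (h + h) s = 2 * alternateSum g h s := by
  simp only [alternateSum, Finset.sum_range_add]
  have : ∑ i ∈ Finset.range h, g (s + 2 * (h + i)) = ∑ i ∈ Finset.range h, g (s + 2 * i) :=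
    Finset.sum_congr rfl fun i _ => by rw [add_comm h i, hg i]
  rw [this]
  ring

theorem alternateSum_of_antipode_eq_one_sub {g : ℕ → ℝ} {h s : ℕ}
    (hg : ∀ i, g (s + 2 * (i + h)) = 1 - g (s + 2 * i)) :
    alternateSum g (h + h) s = h := by
  simp only [alternateSum, Finset.sum_range_add]
  have : ∑ i ∈ Finset.range h, g (s + 2 * (h + i)) = ∑ i ∈ Finset.range h, (1 - g (s + 2 * i)) :=
    Finset.sum_congr rfl fun i _ => by rw [add_comm h i, hg i]
  rw [this, Finset.sum_sub_distrib]
  simp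

theorem alternateSum_of_forall_eq {g : ℕ → ℝ} {m s : ℕ} {c : ℝ} (hg : ∀ i, g (s + 2 * i) = c) :
    alternateSum g m s = m * c := by
  simp [alternateSum, hg]

theorem eq_of_add_two_of_odd_periodic {q : ℕ → ℝ} {p : ℕ} (hp : Odd p)
    (hq : ∀ k, q (k + p) = q k) (h2 : ∀ k, q (k + 2) = q k) (k : ℕ) : q k = q 0 := by
  obtain ⟨m, rfl⟩ := hp
  have h2' : ∀ n k, q (k + 2 * n) = q k := by
    intro n
    induction n with
    | zero => simp
    | succ n ih => intro k; rw [mul_add, mul_one, ← add_assoc, h2, ih]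
  have h1 : ∀ k, q (k + 1) = q k := fun k => by
    rw [← hq k, ← h2' m (k + 1)]; congr 1; ring
  induction k with
  | zero => rfl
  | succ k ih => rw [h1, ih]

theorem eq_zero_of_antiperiodic_of_odd {u : ℕ → ℝ} {p d : ℕ} (hp : Odd p)
    (hu : ∀ k, u (k + p) = u k) (hd : ∀ k, u (k + d) = -u k) (k : ℕ) : u k = 0 := by
  have h1 : ∀ n k, u (k + n * d) = (-1) ^ n * u k := by
    intro n
    induction n with
    | zero => simp
    | succ n ih => intro k; rw [add_mul, one_mul, ← add_assoc, hd, ih]; ring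
  have h2 : ∀ n k, u (k + n * p) = u k := by
    intro n
    induction n with
    | zero => simp
    | succ n ih => intro k; rw [add_mul, one_mul, ← add_assoc, hu, ih]
  have h3 := h1 p k
  rw [mul_comm, h2, hp.neg_one_pow] at h3
  linarith

namespace IsBlackIndicator

variable {p : ℕ} {g : ℕ → ℝ}

theorem not_const (hg : IsBlackIndicator p g) (c : ℝ) (h : ∀ k, g k = c) : False := by
  obtain ⟨k, hk⟩ := hg.exists_black
  obtain ⟨k', hk'⟩ := hg.exists_white
  rw [h] at hk hk'
  linarith

theorem eq_of_ne_one_sub (hg : IsBlackIndicator p g) {i j : ℕ} (h : g i ≠ 1 - g j) :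
    g i = g j := by
  rcases hg.zero_or_one i with hi | hi <;> rcases hg.zero_or_one j with hj | hj <;>
    rw [hi, hj] at h ⊢ <;> norm_num at h

theorem exists_nat_sum (hg : IsBlackIndicator p g) (hp : 0 < p) :
    ∃ n : ℕ, 0 < n ∧ n < p ∧ ∑ i ∈ Finset.range p, g i = n := by
  obtain ⟨n, hn, hs, h0, h1⟩ := exists_nat_sum_eq hg.zero_or_one hp hg.periodic
  refine ⟨n, Nat.pos_of_ne_zero fun h => hg.not_const _ (h0 h),
    lt_of_le_of_ne hn fun h => hg.not_const _ (h1 h), hs⟩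

/-! ### Types 1, 2 and 3 -/

theorem possibleConstants_type1 {x z t y a b : ℝ} {n : ℕ} (hg : IsBlackIndicator p g)
    (hn : p = n + 1) (hS : ∀ k, weightedSum g (CycleType.word x y z t n .type1) k =
      b + (a - b) * g k) : PossibleConstants p x y z t a b .type1 := by
  subst hn
  obtain ⟨N, hN0, hNp, hN⟩ := hg.exists_nat_sum (Nat.succ_pos n)
  have hS' : ∀ k, (z - x) * g k + x * N = b + (a - b) * g k := fun k => by
    rw [← hS k, ← hN, ← sum_range_add_left_of_periodic hg.periodic k, Finset.sum_range_succ']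
    simp only [CycleType.word, weightedSum_append, weightedSum_wordPow_singleton, weightedSum,
      List.length_singleton, add_zero]
    rw [Finset.sum_congr rfl (g := fun i => g (k + 1 + i)) (fun i _ => by congr 1; ring)]
    ring
  obtain ⟨k, hk⟩ := hg.exists_black
  obtain ⟨k', hk'⟩ := hg.exists_white
  have h1 := hS' k
  have h2 := hS' k'
  rw [hk] at h1
  rw [hk'] at h2
  obtain ⟨α, rfl⟩ : ∃ α, N = α + 1 := ⟨N - 1, by omega⟩
  push_cast at h1 h2
  exact ⟨α, by omega, by linarith, by linarith⟩

theorem possibleConstants_type2 {x z t y a b : ℝ} {n : ℕ} (hg : IsBlackIndicator p g)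
    (hn : p = 2 * n + 2) (hxt : x ≠ t)
    (hS : ∀ k, weightedSum g (CycleType.word x y z t n .type2) k =
      b + (a - b) * g k) : PossibleConstants p x y z t a b .type2 := by
  obtain ⟨N, hN0, hNp, hN⟩ := hg.exists_nat_sum (by omega)
  have hsplit : ∀ k, ∑ i ∈ Finset.range p, g (k + i) = ∑ i ∈ Finset.range (n + 1), g (k + i) +
      ∑ i ∈ Finset.range (n + 1), g (k + (n + 1) + i) := fun k => by
    rw [show p = (n + 1) + (n + 1) by omega, Finset.sum_range_add]
    simp only [add_assoc]
  have hS' : ∀ k, (z - x) * g k + (t - x) * g (k + (n + 1)) + x * N = b + (a - b) * g k :=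
    fun k => by
    rw [← hS k, ← hN, ← sum_range_add_left_of_periodic hg.periodic k, hsplit,
      Finset.sum_range_succ', Finset.sum_range_succ']
    simp only [CycleType.word, weightedSum_append, weightedSum_wordPow_singleton, weightedSum,
      List.length_singleton, add_zero, List.length_append, length_wordPow, mul_one]
    rw [Finset.sum_congr rfl (g := fun i => g (k + 1 + i)) (fun i _ => by congr 1; ring),
      Finset.sum_congr rfl (g := fun i => g (k + (1 + n + 1) + i))
        (f := fun i => g (k + (n + 1) + (i + 1))) (fun i _ => by congr 1; ring),
      add_comm 1 n]
    ring
  have hper : ∀ k, g (k + (n + 1) + (n + 1)) = g k := fun k => by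
    rw [← hg.periodic k, hn]; congr 1; ring
  obtain ⟨k, hk⟩ := hg.exists_black
  obtain ⟨k', hk'⟩ := hg.exists_white
  have h1 := hS' k
  have h2 := hS' k'
  have hsum := hsplit 0
  simp only [zero_add] at hsum
  rw [hN] at hsum
  have hp : (p : ℝ) = 2 * n + 2 := by rw [hn]; push_cast; ring
  rcases antipode_eq_or_eq_one_sub hg.zero_or_one hper (fun k k' h => by
    have h1 := hS' k
    have h2 := hS' k'
    rw [h] at h1
    have : (t - x) * (g (k + (n + 1)) - g (k' + (n + 1))) = 0 := by linarith
    rcases mul_eq_zero.1 this with h | h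
    · exact absurd (sub_eq_zero.1 h).symm hxt
    · linarith) with h | h
  · rw [h, hk] at h1
    rw [h, hk'] at h2
    left
    obtain ⟨M, hM, hMs, -⟩ := exists_nat_sum_eq hg.zero_or_one (Nat.succ_pos n) h
    rw [Finset.sum_congr rfl (g := g) (f := fun i => g (n + 1 + i)) fun i _ => by rw [add_comm, h],
      hMs] at hsum
    have hNM : N = M + M := by exact_mod_cast hsum
    obtain ⟨α, rfl⟩ : ∃ α, M = α + 1 := ⟨M - 1, by omega⟩
    rw [hNM] at h1 h2
    push_cast at h1 h2
    exact ⟨α, by omega, by linarith, by linarith⟩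
  · rw [h, hk] at h1
    rw [h, hk'] at h2
    right
    rw [Finset.sum_congr rfl (g := fun i => 1 - g i) (f := fun i => g (n + 1 + i))
      fun i _ => by rw [add_comm, h],
      Finset.sum_sub_distrib] at hsum
    simp only [Finset.sum_const, Finset.card_range, nsmul_eq_mul, mul_one] at hsum
    push_cast at hsum
    have hN' : (N : ℝ) = n + 1 := by linarith
    rw [hN'] at h1 h2
    rw [hp]
    constructor <;> linarith

/-- Consecutive differences of `g` satisfy `A * (g (k + 2) - g (k + 1)) = B * (g (k + 1) - g k)`
with `A + B = y - x ≠ 0`. Going once around the cycle of odd length gives `A ^ p = B ^ p`, hence `A = B`,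
and `g` would be a periodic affine function. -/
theorem not_type3 {x z t y a b : ℝ} {n : ℕ} (hg : IsBlackIndicator p g)
    (hn : p = 2 * n + 1) (hxy : x ≠ y)
    (hS : ∀ k, weightedSum g (CycleType.word x y z t n .type3) k =
      b + (a - b) * g k) : False := by
  subst hn
  have hS' : ∀ k, z * g k + x * alternateSum g n (k + 1) + y * alternateSum g n (k + 2) =
      b + (a - b) * g k := fun k => by
    rw [← hS k]
    simp only [CycleType.word, weightedSum_append, weightedSum_wordPow_pair, weightedSum,
      List.length_singleton]
    ring
  have hA : ∀ k, (a - b - z + y) * (g (k + 2) - g (k + 1)) =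
      (-(a - b) + z - x) * (g (k + 1) - g k) := fun k => by
    have h1 := hS' k
    have h2 := hS' (k + 2)
    have e1 := alternateSum_add_two g n (k + 1)
    have e2 := alternateSum_add_two g n (k + 2)
    have p1 := hg.periodic k
    have p2 := hg.periodic (k + 1)
    rw [show k + 2 + 1 = k + 1 + 2 by ring, e1, e2, show k + 1 + 2 * n = k + (2 * n + 1) by ring,
      show k + 2 + 2 * n = k + 1 + (2 * n + 1) by ring, p1, p2] at h2
    linear_combination h1 - h2
  generalize hAd : a - b - z + y = A at hA
  generalize hBd : -(a - b) + z - x = B at hA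
  have hAB : A + B ≠ 0 := by
    intro h; apply hxy; linarith
  have hu : ∃ k, g (k + 1) ≠ g k := by
    by_contra! h
    refine hg.not_const (g 0) fun k => ?_
    induction k with
    | zero => rfl
    | succ k ih => rw [h, ih]
  obtain ⟨k, hk⟩ := hu
  have hk : g (k + 1) - g k ≠ 0 := sub_ne_zero.2 hk
  have hpos : ∀ n, A ^ n * (g (k + n + 1) - g (k + n)) = B ^ n * (g (k + 1) - g k) := by
    intro n
    induction n with
    | zero => simp
    | succ n ih =>
      have := hA (k + n)
      rw [show k + (n + 1) + 1 = k + n + 2 by ring, show k + (n + 1) = k + n + 1 by ring, pow_succ,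
        pow_succ]
      linear_combination A ^ n * this + B * ih
  have hpow := hpos (2 * n + 1)
  have e1 := hg.periodic (k + 1)
  rw [show k + 1 + (2 * n + 1) = k + (2 * n + 1) + 1 by ring] at e1
  rw [e1, hg.periodic k] at hpow
  have hAB' : A = B := (Odd.strictMono_pow ⟨n, rfl⟩).injective (mul_right_cancel₀ hk hpow)
  have hA0 : A ≠ 0 := by
    intro h; apply hAB; rw [← hAB', h, add_zero]
  have hstep : ∀ n, g (n + 1) - g n = g 1 - g 0 := by
    intro n
    induction n with
    | zero => rfl
    | succ n ih =>
      rw [← ih]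
      have := hA n
      rw [← hAB'] at this
      exact mul_left_cancel₀ hA0 this
  have hlin : ∀ n : ℕ, g n = g 0 + n * (g 1 - g 0) := by
    intro n
    induction n with
    | zero => simp
    | succ n ih => have := hstep n; push_cast; linarith
  have h0 := hlin (0 + (2 * n + 1))
  rw [hg.periodic 0] at h0
  have : ((0 + (2 * n + 1) : ℕ) : ℝ) * (g 1 - g 0) = 0 := by linarith
  rcases mul_eq_zero.1 this with h | h
  · norm_cast at h
  · exact hg.not_const (g 0) fun k => by rw [hlin, h, mul_zero, add_zero]

/-! ### Types 4, 7 and 8 -/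

/-- If the two parity classes contain different numbers of black vertices and neighbours of equal
colours have antipodes of equal colours, then neighbours have different colours: otherwise the
sums `S` at two neighbours of the same colour would differ by a nonzero multiple of `y - x`. -/
theorem succ_eq_one_sub_of_alternateSum_ne {h : ℕ} {A B x y a b : ℝ} (hg : IsBlackIndicator p g)
    (hp : p = 2 * h) (hxy : x ≠ y)
    (hS : ∀ k, A * g k + B * g (k + h) + y * alternateSum g h k + x * alternateSum g h (k + 1) =
      b + (a - b) * g k)
    (hE : alternateSum g h 0 ≠ alternateSum g h 1)
    (hdep : ∀ k, g (k + 1) = g k → B * g (k + 1 + h) = B * g (k + h)) (k : ℕ) :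
    g (k + 1) = 1 - g k := by
  subst hp
  by_contra hne
  have heq := hg.eq_of_ne_one_sub hne
  have h1 := hS k
  have h2 := hS (k + 1)
  rw [alternateSum_add_two_of_periodic hg.periodic, heq] at h2
  have h3 := hdep k heq
  have : (y - x) * (alternateSum g h k - alternateSum g h (k + 1)) = 0 := by linarith
  rcases mul_eq_zero.1 this with h | h
  · exact hxy (sub_eq_zero.1 h).symm
  · exact alternateSum_ne_succ_of_periodic hg.periodic hE k (sub_eq_zero.1 h)

theorem alternateSum_of_succ_eq_one_sub {h : ℕ} (hg : ∀ k, g (k + 1) = 1 - g k) (k : ℕ) :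
    alternateSum g h k = h * g k :=
  alternateSum_of_forall_eq fun i => by
    induction i with
    | zero => rfl
    | succ i ih => rw [show k + 2 * (i + 1) = k + 2 * i + 1 + 1 by ring, hg, hg, ih]; ring

/-- If both parity classes contain the same number of black vertices, then this number is neither
`0` nor `h`, because both colours occur. -/
theorem exists_nat_alternateSum_of_eq {h : ℕ} (hg : IsBlackIndicator p g) (hp : p = 2 * h)
    (h0 : 0 < h) (hE : alternateSum g h 0 = alternateSum g h 1) :
    ∃ n : ℕ, 0 < n ∧ n < h ∧ ∀ k, alternateSum g h k = n := by
  subst hp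
  obtain ⟨n, hn, hns, hn0, hn1⟩ := exists_nat_alternateSum_eq hg.zero_or_one h0 hg.periodic 0
  obtain ⟨n', hn', hns', hn0', hn1'⟩ := exists_nat_alternateSum_eq hg.zero_or_one h0 hg.periodic 1
  obtain rfl : n = n' := by
    have : (n : ℝ) = n' := by linarith
    exact_mod_cast this
  have hall : ∀ c, (∀ i, g (0 + 2 * i) = c) → (∀ i, g (1 + 2 * i) = c) → ∀ k, g k = c := by
    intro c e o k
    rcases Nat.even_or_odd' k with ⟨i, rfl | rfl⟩
    · simpa using e i
    · rw [add_comm]; exact o i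
  refine ⟨n, Nat.pos_of_ne_zero fun e => hg.not_const 0 (hall 0 (hn0 e) (hn0' e)),
    lt_of_le_of_ne hn fun e => hg.not_const 1 (hall 1 (hn1 e) (hn1' e)), fun k => ?_⟩
  induction k using Nat.twoStepInduction with
  | zero => exact hns
  | one => exact hns'
  | more k ih _ => rw [alternateSum_add_two_of_periodic hg.periodic, ih]

theorem possibleConstants_type4 {x z t y a b : ℝ} {n : ℕ} (hg : IsBlackIndicator p g)
    (hn : p = 2 * n + 2) (hxy : x ≠ y)
    (hS : ∀ k, weightedSum g (CycleType.word x y z t n .type4) k =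
      b + (a - b) * g k) : PossibleConstants p x y z t a b .type4 := by
  have hp : p = 2 * (n + 1) := by omega
  have hpr : (p : ℝ) = 2 * n + 2 := by rw [hn]; push_cast; ring
  have hS' : ∀ k, (z - y) * g k + 0 * g (k + (n + 1)) + y * alternateSum g (n + 1) k +
      x * alternateSum g (n + 1) (k + 1) = b + (a - b) * g k := fun k => by
    have e1 := alternateSum_add g 1 n k
    have e2 := alternateSum_add g n 1 (k + 1)
    rw [alternateSum_one] at e1 e2
    rw [← hS k, add_comm n 1, e1, add_comm 1 n, e2]
    simp only [CycleType.word, weightedSum_append, weightedSum_wordPow_pair, weightedSum,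
      List.length_append, length_wordPow, List.length_cons, List.length_nil]
    ring_nf
  obtain ⟨k, hk⟩ := hg.exists_black
  obtain ⟨k', hk'⟩ := hg.exists_white
  have h1 := hS' k
  have h2 := hS' k'
  rw [hk] at h1
  rw [hk'] at h2
  by_cases hE : alternateSum g (n + 1) 0 = alternateSum g (n + 1) 1
  · obtain ⟨N, hN0, hN1, hN⟩ := hg.exists_nat_alternateSum_of_eq hp (Nat.succ_pos n) hE
    obtain ⟨α, rfl⟩ : ∃ α, N = α + 1 := ⟨N - 1, by omega⟩
    simp only [hN] at h1 h2
    push_cast at h1 h2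
    left
    exact ⟨α, by omega, by linarith, by linarith⟩
  · have halt := hg.succ_eq_one_sub_of_alternateSum_ne hp hxy hS' hE (fun k _ => by simp)
    simp only [alternateSum_of_succ_eq_one_sub halt, halt k, halt k', hk, hk'] at h1 h2
    push_cast at h1 h2
    right
    rw [hpr]
    constructor <;> linarith

theorem possibleConstants_type7 {x z t y a b : ℝ} {n : ℕ} (hg : IsBlackIndicator p g)
    (hn : p = 4 * n + 2) (hxy : x ≠ y) (htx : t ≠ x)
    (hS : ∀ k, weightedSum g (CycleType.word x y z t n .type7) k =
      b + (a - b) * g k) : PossibleConstants p x y z t a b .type7 := by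
  obtain ⟨h, hh⟩ : ∃ h, h = 2 * n + 1 := ⟨_, rfl⟩
  have hp : p = 2 * h := by omega
  have hpr : (p : ℝ) = 2 * h := by rw [hp]; push_cast; ring
  have hS' : ∀ k, (z - y) * g k + (t - x) * g (k + h) + y * alternateSum g h k +
      x * alternateSum g h (k + 1) = b + (a - b) * g k := fun k => by
    have e1 := alternateSum_add g (1 + n) n k
    have e2 := alternateSum_add g 1 n k
    have e3 := alternateSum_add g (n + 1) n (k + 1)
    have e4 := alternateSum_add g n 1 (k + 1)
    rw [alternateSum_one] at e2 e4
    rw [e2, show 1 + n + n = h by omega] at e1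
    rw [e4, show n + 1 + n = h by omega] at e3
    rw [← hS k, e1, e3, hh]
    simp only [CycleType.word, weightedSum_append, weightedSum_wordPow_pair, weightedSum,
      List.length_append, length_wordPow, List.length_cons, List.length_nil]
    ring_nf
  have hper : ∀ k, g (k + h + h) = g k := fun k => by
    rw [← hg.periodic k, hp]; congr 1; ring
  obtain ⟨k, hk⟩ := hg.exists_black
  obtain ⟨k', hk'⟩ := hg.exists_white
  have h1 := hS' k
  have h2 := hS' k'
  rw [hk] at h1
  rw [hk'] at h2
  by_cases hE : alternateSum g h 0 = alternateSum g h 1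
  · obtain ⟨N, hN0, hN1, hN⟩ := hg.exists_nat_alternateSum_of_eq hp (by omega) hE
    simp only [hN] at h1 h2 hS'
    rcases antipode_eq_or_eq_one_sub hg.zero_or_one hper (fun k k' e => by
      have h1 := hS' k
      have h2 := hS' k'
      rw [e] at h1
      exact mul_left_cancel₀ (sub_ne_zero.2 htx) (by linarith)) with e | e
    · rw [e, hk] at h1
      rw [e, hk'] at h2
      obtain ⟨α, rfl⟩ : ∃ α, N = α + 1 := ⟨N - 1, by omega⟩
      push_cast at h1 h2
      right
      exact ⟨α, by omega, by linarith, by linarith⟩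
    · -- Exactly half of the vertices are black, so `h = 2 * N`, although `h` is odd.
      exfalso
      have hsum : alternateSum g h 0 + alternateSum g h 1 = h := by
        have e1 : alternateSum g h (0 + (2 * n + 1)) = h - alternateSum g h 0 := by
          simp only [alternateSum]
          rw [Finset.sum_congr rfl (g := fun i => 1 - g (0 + 2 * i)), Finset.sum_sub_distrib]
          · simp
          · intro i _
            rw [← e, hh]; congr 1; ring
        rw [hN, hN] at e1
        rw [hN, hN]
        linarith
      rw [hN, hN] at hsum
      have : N + N = h := by exact_mod_cast hsum
      omega
  · have hper' : ∀ k, g (k + 2 * h) = g k := hp ▸ hg.periodic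
    -- Antipodes have different parities. If two of them had the same colour, then the sums at
    -- these two vertices would differ.
    have hanti : ∀ k, g (k + h) = 1 - g k := by
      intro k
      by_contra hne
      have heq := hg.eq_of_ne_one_sub hne
      have h1 := hS' k
      have h2 := hS' (k + h)
      have e1 := alternateSum_add_two_mul_of_periodic hper' k (n + 1)
      have e2 := alternateSum_add_two_mul_of_periodic hper' (k + 1) n
      rw [show k + 2 * (n + 1) = k + h + 1 by omega] at e1
      rw [show k + 1 + 2 * n = k + h by omega] at e2
      rw [hper, heq, e1] at h2
      rw [heq] at h1
      rw [e2] at h2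
      have : (y - x) * (alternateSum g h k - alternateSum g h (k + 1)) = 0 := by linarith
      rcases mul_eq_zero.1 this with h | h
      · exact hxy (sub_eq_zero.1 h).symm
      · exact alternateSum_ne_succ_of_periodic hper' hE k (sub_eq_zero.1 h)
    have halt := hg.succ_eq_one_sub_of_alternateSum_ne hp hxy hS' hE
      (fun k e => by rw [hanti, hanti, e])
    simp only [alternateSum_of_succ_eq_one_sub halt, hanti, halt k, halt k', hk, hk'] at h1 h2
    left
    rw [hpr]
    constructor <;> linarith

theorem possibleConstants_type8 {x z t y a b : ℝ} {n : ℕ} (hg : IsBlackIndicator p g)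
    (hn : p = 4 * n + 4) (hxy : x ≠ y) (hyt : y ≠ t)
    (hS : ∀ k, weightedSum g (CycleType.word x y z t n .type8) k =
      b + (a - b) * g k) : PossibleConstants p x y z t a b .type8 := by
  obtain ⟨q, hq⟩ : ∃ q, q = n + 1 := ⟨_, rfl⟩
  obtain ⟨h, hh⟩ : ∃ h, h = q + q := ⟨_, rfl⟩
  have hp : p = 2 * h := by omega
  have hhr : (h : ℝ) = 2 * q := by rw [hh]; push_cast; ring
  have hpr : (p : ℝ) = 4 * q := by rw [hp]; push_cast; linarith
  have hS' : ∀ k, (z - y) * g k + (t - y) * g (k + h) + y * alternateSum g h k +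
      x * alternateSum g h (k + 1) = b + (a - b) * g k := fun k => by
    have e1 := alternateSum_add g (1 + n) (1 + n) k
    have e2 := alternateSum_add g 1 n
    have e3 := alternateSum_add g (n + 1) (1 + n) (k + 1)
    have e4 := alternateSum_add g n 1 (k + 1)
    rw [alternateSum_one] at e4
    simp only [alternateSum_one] at e2
    rw [e2, e2, show 1 + n + (1 + n) = h by omega] at e1
    rw [e4, e2, show n + 1 + (1 + n) = h by omega] at e3
    rw [← hS k, e1, e3, hh, hq]
    simp only [CycleType.word, weightedSum_append, weightedSum_wordPow_pair, weightedSum,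
      List.length_append, length_wordPow, List.length_cons, List.length_nil]
    ring_nf
  have hper : ∀ k, g (k + h + h) = g k := fun k => by
    rw [← hg.periodic k, hp]; congr 1; ring
  have hEper := alternateSum_add_two_mul_of_periodic (g := g) (h := h)
    (fun k => hp ▸ hg.periodic k)
  obtain ⟨k, hk⟩ := hg.exists_black
  obtain ⟨k', hk'⟩ := hg.exists_white
  have h1 := hS' k
  have h2 := hS' k'
  rw [hk] at h1
  rw [hk'] at h2
  by_cases hE : alternateSum g h 0 = alternateSum g h 1
  · obtain ⟨N, hN0, hN1, hN⟩ := hg.exists_nat_alternateSum_of_eq hp (by omega) hE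
    simp only [hN] at h1 h2 hS'
    rcases antipode_eq_or_eq_one_sub hg.zero_or_one hper (fun k k' e => by
      have h1 := hS' k
      have h2 := hS' k'
      rw [e] at h1
      exact mul_left_cancel₀ (sub_ne_zero.2 hyt.symm) (by linarith)) with e | e
    · rw [e, hk] at h1
      rw [e, hk'] at h2
      obtain ⟨M, hM, hMs, -⟩ := exists_nat_alternateSum_eq hg.zero_or_one (m := q) (by omega)
        (fun k => by rw [two_mul, ← hh, e]) 0
      have hNM : N = 2 * M := by
        have := alternateSum_of_antipode_eq (g := g) (h := q) (s := 0) (fun i => by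
          rw [← e (0 + 2 * i)]; congr 1; omega)
        rw [← hh, hN, hMs] at this
        exact_mod_cast this
      obtain ⟨α, rfl⟩ : ∃ α, M = α + 1 := ⟨M - 1, by omega⟩
      rw [hNM] at h1 h2
      push_cast at h1 h2
      right; left
      exact ⟨α, by omega, by linarith, by linarith⟩
    · have hNq : (N : ℝ) = q := by
        have := alternateSum_of_antipode_eq_one_sub (g := g) (h := q) (s := 0) (fun i => by
          rw [← e]; congr 1; omega)
        rw [← hh, hN] at this
        exact this
      rw [e, hk, hNq] at h1
      rw [e, hk', hNq] at h2
      right; right; left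
      rw [hpr]
      constructor <;> linarith
  -- Within each parity class, the colour of a vertex determines the colour of its antipode.
  have hcls : ∀ s, (∀ i, g (s + 2 * (i + q)) = g (s + 2 * i)) ∨
      ∀ i, g (s + 2 * (i + q)) = 1 - g (s + 2 * i) := by
    intro s
    refine antipode_eq_or_eq_one_sub (q := fun i => g (s + 2 * i)) (h := q)
      (fun i => hg.zero_or_one _) (fun i => ?_) fun i j e => ?_
    · rw [← hper (s + 2 * i)]; congr 1; omega
    · have h1 := hS' (s + 2 * i)
      have h2 := hS' (s + 2 * j)
      change g (s + 2 * i) = g (s + 2 * j) at e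
      rw [hEper, show s + 2 * i + 1 = s + 1 + 2 * i by ring, hEper, e,
        show s + 2 * i + h = s + 2 * (i + q) by omega] at h1
      rw [hEper, show s + 2 * j + 1 = s + 1 + 2 * j by ring, hEper,
        show s + 2 * j + h = s + 2 * (j + q) by omega] at h2
      exact mul_left_cancel₀ (sub_ne_zero.2 hyt.symm) (by linarith)
  -- The case in which antipodes differ in exactly one parity class, that of `s`.
  have hmixed : ∀ s, (∀ i, g (s + 2 * (i + q)) = 1 - g (s + 2 * i)) →
      (∀ i, g (s + 1 + 2 * (i + q)) = g (s + 1 + 2 * i)) →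
      PossibleConstants p x y z t a b .type8 := by
    intro s ha he
    have hEs : alternateSum g h s = q := by
      rw [hh]; exact alternateSum_of_antipode_eq_one_sub ha
    have hSs : ∀ i, (z - y) * g (s + 2 * i) + (t - y) * (1 - g (s + 2 * i)) + y * q +
        x * alternateSum g h (s + 1) = b + (a - b) * g (s + 2 * i) := fun i => by
      rw [← hS', hEper, show s + 2 * i + 1 = s + 1 + 2 * i by ring, hEper, hEs,
        show s + 2 * i + h = s + 2 * (i + q) by omega, ha]
    have hSs' : ∀ i, (z - y + (t - y)) * g (s + 1 + 2 * i) + y * alternateSum g h (s + 1) +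
        x * q = b + (a - b) * g (s + 1 + 2 * i) := fun i => by
      rw [← hS', hEper, show s + 1 + 2 * i + 1 = s + 2 * (i + 1) by ring, hEper, hEs,
        show s + 1 + 2 * i + h = s + 1 + 2 * (i + q) by omega, he]
      ring
    obtain ⟨hb, hw⟩ : (z - y) + y * q + x * alternateSum g h (s + 1) = a ∧
        (t - y) + y * q + x * alternateSum g h (s + 1) = b := by
      have e1 := hSs 0
      have e2 := hSs (0 + q)
      rw [ha] at e2
      rcases hg.zero_or_one (s + 2 * 0) with e | e <;> rw [e] at e1 e2 <;> constructor <;> linarith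
    -- A black and a white vertex in the other class would give `a - b = z + t - 2 * y`, whereas
    -- `hb` and `hw` give `a - b = z - t`; so `t = y`.
    have hconst : ∀ i, g (s + 1 + 2 * i) = g (s + 1 + 2 * 0) := by
      intro i
      by_contra hne
      have e1 := hSs' i
      have e2 := hSs' 0
      apply hyt
      rcases hg.zero_or_one (s + 1 + 2 * i) with e | e <;>
        rcases hg.zero_or_one (s + 1 + 2 * 0) with e' | e' <;> rw [e] at e1 hne <;>
        rw [e'] at e2 hne <;> first | exact absurd rfl hne | linarith
    have e1 := hSs' 0
    have hE1 := alternateSum_of_forall_eq (m := h) hconst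
    have e0 := hg.zero_or_one (s + 1 + 2 * 0)
    right; right; right
    rw [hpr]
    rcases e0 with e | e <;> rw [e] at e1 hE1 <;> rw [hE1] at e1 hb hw <;> rw [hhr] at e1 hb hw
    · right
      refine ⟨?_, ?_, ?_⟩ <;> linarith
    · left
      refine ⟨?_, ?_, ?_⟩ <;> linarith
  rcases hcls 0 with c0 | c0 <;> rcases hcls 1 with c1 | c1
  · have heq : ∀ k, g (k + h) = g k := by
      intro k
      rcases Nat.even_or_odd' k with ⟨i, rfl | rfl⟩
      · have := c0 i
        rw [zero_add, zero_add] at this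
        rw [← this]; congr 1; omega
      · have := c1 i
        rw [add_comm 1 (2 * i)] at this
        rw [← this]; congr 1; omega
    have halt := hg.succ_eq_one_sub_of_alternateSum_ne hp hxy hS' hE
      (fun k e => by rw [heq, heq, e])
    simp only [alternateSum_of_succ_eq_one_sub halt, heq, halt k, halt k', hk, hk', hhr] at h1 h2
    left
    rw [hpr]
    constructor <;> linarith
  · exact hmixed 1 c1 fun i => by
      have := c0 (i + 1)
      rw [show 1 + 1 + 2 * (i + q) = 0 + 2 * (i + 1 + q) by ring, this]; congr 1; ring
  · exact hmixed 0 c0 c1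
  · exact absurd (by rw [hh, alternateSum_of_antipode_eq_one_sub c0,
      alternateSum_of_antipode_eq_one_sub c1]) hE

/-! ### Types 5 and 6 -/

theorem not_add_one_periodic (hg : IsBlackIndicator p g) (h : ∀ k, g (k + 1) = g k) : False :=
  hg.not_const (g 0) fun k => by
    induction k with
    | zero => rfl
    | succ k ih => rw [h, ih]

theorem not_add_two_periodic (hg : IsBlackIndicator p g) (hp : Odd p)
    (h : ∀ k, g (k + 2) = g k) : False :=
  hg.not_const (g 0) (eq_of_add_two_of_odd_periodic hp hg.periodic h)

/-- Since `g` has values in `{0, 1}`, the recurrence forces `C = ± D`. For `C = -D` the differences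
`g (k + 1) - g k` would be antiperiodic with period `3`, which the odd period `p` excludes; for
`C = D` the differences `g (k + 3) - g k` change sign at each step, so they vanish. -/
theorem periodic_three_of_recurrence (hg : IsBlackIndicator p g) (hp : Odd p) {C D : ℝ}
    (hD : D ≠ 0) (hrec : ∀ k, C * (g (k + 4) - g k) = D * (g (k + 1) - g (k + 3))) :
    C = D ∧ p % 3 = 0 ∧ ∀ k, g (k + 3) = g k := by
  have hCD : C = D ∨ C = -D := by
    by_contra! ⟨hne, hne'⟩
    have hstep : ∀ k, g (k + 1 + 2) = g (k + 1) := by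
      intro k
      have := hrec k
      rw [show k + 3 = k + 1 + 2 by ring] at this
      rcases hg.zero_or_one (k + 4) with e4 | e4 <;> rcases hg.zero_or_one k with e0 | e0 <;>
        rcases hg.zero_or_one (k + 1) with e1 | e1 <;>
        rcases hg.zero_or_one (k + 1 + 2) with e3 | e3 <;> rw [e4, e0, e1, e3] at this <;>
        rw [e1, e3] <;> exfalso <;>
        first
        | exact hD (by linarith)
        | exact hne (by linarith)
        | exact hne' (by linarith)
    refine hg.not_add_two_periodic hp fun k => ?_
    rw [← hg.periodic k, ← hg.periodic (k + 2)]
    obtain ⟨m, rfl⟩ := hp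
    have := hstep (k + 2 * m)
    rw [show k + 2 + (2 * m + 1) = k + 2 * m + 1 + 2 by ring, this]
    rfl
  rcases hCD with rfl | rfl
  · have hdiff : ∀ k, g (k + 3) - g k = 0 :=
      eq_zero_of_antiperiodic_of_odd (u := fun k => g (k + 3) - g k) (d := 1) hp
        (fun k => by
          rw [hg.periodic, show k + p + 3 = k + 3 + p by ring, hg.periodic])
        (fun k => by linarith [mul_left_cancel₀ hD (hrec k)])
    have h3 : ∀ k, g (k + 3) = g k := fun k => sub_eq_zero.1 (hdiff k)
    refine ⟨rfl, ?_, h3⟩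
    have hmul : ∀ n k, g (k + n * 3) = g k := fun n k => Function.Periodic.nat_mul h3 n k
    by_contra hne
    have : p % 3 = 1 ∨ p % 3 = 2 := by omega
    rcases this with h | h
    · refine hg.not_add_one_periodic fun k => ?_
      rw [← hmul (p / 3), show k + 1 + p / 3 * 3 = k + p by omega, hg.periodic]
    · refine hg.not_add_two_periodic hp fun k => ?_
      rw [← hmul (p / 3), show k + 2 + p / 3 * 3 = k + p by omega, hg.periodic]
  · exfalso
    refine hg.not_add_one_periodic fun k => sub_eq_zero.1 ?_
    refine eq_zero_of_antiperiodic_of_odd (u := fun k => g (k + 1) - g k) (d := 3) hp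
      (fun k => by
        rw [hg.periodic, show k + p + 1 = k + 1 + p by ring, hg.periodic])
      (fun k => ?_) k
    have : D * (g (k + 4) - g k) = D * (g (k + 3) - g (k + 1)) := by linarith [hrec k]
    change g (k + 4) - g (k + 3) = -(g (k + 1) - g k)
    linarith [mul_left_cancel₀ hD this]

/-- The residue `q` is the half of `1` modulo `p`, so that the substitution `k = q j` turns the
shifts by `2`, `q` and `q + 1` into the shifts by `4`, `1` and `3`. -/
theorem periodic_three_of_local_relation (hg : IsBlackIndicator p g) {q : ℕ}
    (hq : 2 * q = p + 1) {C D : ℝ} (hD : D ≠ 0)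
    (hrel : ∀ k, C * (g (k + 2) - g k) = D * (g (k + q) - g (k + q + 1))) :
    C = D ∧ p % 3 = 0 ∧ ∀ k, g (k + 3) = g k := by
  have hmul : ∀ n k, g (k + n * p) = g k := fun n k => Function.Periodic.nat_mul hg.periodic n k
  have hG2 : ∀ j, g (q * (2 * j)) = g j := fun j => by
    rw [show q * (2 * j) = j + j * p by rw [← mul_assoc, mul_comm q 2, hq]; ring, hmul]
  have hG : IsBlackIndicator p fun j => g (q * j) := by
    refine ⟨fun k => hg.zero_or_one _, fun k => ?_, ?_, ?_⟩
    · rw [mul_add, hmul]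
    · obtain ⟨k, hk⟩ := hg.exists_black
      exact ⟨2 * k, by rw [hG2, hk]⟩
    · obtain ⟨k, hk⟩ := hg.exists_white
      exact ⟨2 * k, by rw [hG2, hk]⟩
  obtain ⟨h1, h2, h3⟩ := hG.periodic_three_of_recurrence ⟨q - 1, by omega⟩ hD (C := C) fun k => by
    have := hrel (q * k)
    rw [show q * (k + 4) = q * k + 2 + 2 * p by linarith, hmul,
      show q * (k + 3) = q * k + q + 1 + p by linarith, hg.periodic, mul_add q k 1, mul_one]
    exact this
  refine ⟨h1, h2, fun k => ?_⟩
  rw [← hG2 k, ← h3, ← h3, ← hG2]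
  rfl

theorem sum_eq_of_periodic_three (hg : IsBlackIndicator p g) (hp : p % 3 = 0)
    (h3 : ∀ k, g (k + 3) = g k) :
    ∑ i ∈ Finset.range p, g i = p / 3 ∨ ∑ i ∈ Finset.range p, g i = 2 * p / 3 := by
  obtain ⟨r, rfl⟩ := Nat.dvd_of_mod_eq_zero hp
  have hsum : ∀ r, ∑ i ∈ Finset.range (3 * r), g i = r * (g 0 + g 1 + g 2) := by
    intro r
    induction r with
    | zero => simp
    | succ r ih =>
      have hmul : ∀ k, g (3 * r + k) = g k := fun k => by
        rw [add_comm, mul_comm]; exact Function.Periodic.nat_mul h3 r k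
      rw [mul_add, mul_one, Finset.sum_range_add, ih]
      simp only [hmul, Finset.sum_range_succ, Finset.sum_range_zero]
      push_cast
      ring
  have hall : ∀ c, g 0 = c → g 1 = c → g 2 = c → False := fun c h0 h1 h2 =>
    hg.not_const c fun k => by
      rw [← Function.Periodic.map_mod_nat h3 k]
      have : k % 3 < 3 := Nat.mod_lt _ (by norm_num)
      interval_cases k % 3 <;> assumption
  rw [hsum]
  push_cast
  rcases hg.zero_or_one 0 with e0 | e0 <;> rcases hg.zero_or_one 1 with e1 | e1 <;>
    rcases hg.zero_or_one 2 with e2 | e2 <;> rw [e0, e1, e2] <;>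
    first
    | exact (hall _ e0 e1 e2).elim
    | (left; ring1)
    | (right; ring1)

theorem possibleConstants_type5 {x z t y a b : ℝ} {n : ℕ} (hg : IsBlackIndicator p g)
    (hn : p = 4 * n + 1) (hxy : x ≠ y)
    (hS : ∀ k, weightedSum g (CycleType.word x y z t n .type5) k =
      b + (a - b) * g k) : PossibleConstants p x y z t a b .type5 := by
  have hpr : (p : ℝ) = 4 * n + 1 := by rw [hn]; push_cast; ring
  have hS' : ∀ k, z * g k + x * alternateSum g n (k + 1) + y * alternateSum g n (k + 2) +
      y * alternateSum g n (k + (2 * n + 1)) + x * alternateSum g n (k + (2 * n + 2)) =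
      b + (a - b) * g k := fun k => by
    rw [← hS k]
    simp only [CycleType.word, weightedSum_append, weightedSum_wordPow_pair, weightedSum,
      List.length_append, length_wordPow, List.length_cons, List.length_nil]
    ring_nf
  obtain ⟨hC, hp3, h3⟩ := hg.periodic_three_of_local_relation (q := 2 * n + 1) (by omega)
    (C := a - b - z + y) (D := x - y) (sub_ne_zero.2 hxy) fun k => by
    have h1 := hS' k
    have h2 := hS' (k + 2)
    have e1 := alternateSum_add_two g n (k + 1)
    have e2 := alternateSum_add_two g n (k + 2)
    have e3 := alternateSum_add_two g n (k + (2 * n + 1))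
    have e4 := alternateSum_add_two g n (k + (2 * n + 2))
    have p1 := hg.periodic k
    have p2 := hg.periodic (k + 1)
    rw [hn] at p1 p2
    ring_nf at h1 h2 e1 e2 e3 e4 p1 p2 ⊢
    rw [e1, e2, e3, e4, p1, p2] at h2
    linear_combination h1 - h2
  -- Summing `S k = b + (a - b) * g k` over all `k` determines `b`.
  have htot : (z + 2 * n * (x + y)) * ∑ k ∈ Finset.range p, g k =
      p * b + (a - b) * ∑ k ∈ Finset.range p, g k := by
    have := Finset.sum_congr (rfl : Finset.range p = _) fun k _ => hS' k
    simp only [Finset.sum_add_distrib, ← Finset.mul_sum,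
      sum_alternateSum_of_periodic hg.periodic, Finset.sum_const, Finset.card_range,
      nsmul_eq_mul] at this
    linarith
  have hp0 : (p : ℝ) ≠ 0 := by rw [hpr]; positivity
  have hab : a = z + x - 2 * y + b := by linarith
  refine ⟨hp3, ?_⟩
  have hb : ∀ r : ℝ, ∑ k ∈ Finset.range p, g k = r * p →
      b = r * ((p - 1) / 2 * (x + y) - x + 2 * y) := fun r hr => by
    rw [hr, hab] at htot
    apply mul_left_cancel₀ hp0
    rw [hpr] at htot ⊢
    linear_combination -htot
  rcases hg.sum_eq_of_periodic_three hp3 h3 with hN | hN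
  · right
    have := hb (1 / 3) (by rw [hN]; ring)
    constructor <;> linarith
  · left
    have := hb (2 / 3) (by rw [hN]; ring)
    constructor <;> linarith

theorem possibleConstants_type6 {x z t y a b : ℝ} {n : ℕ} (hg : IsBlackIndicator p g)
    (hn : p = 4 * n + 3) (hxy : x ≠ y)
    (hS : ∀ k, weightedSum g (CycleType.word x y z t n .type6) k =
      b + (a - b) * g k) : PossibleConstants p x y z t a b .type6 := by
  have hpr : (p : ℝ) = 4 * n + 3 := by rw [hn]; push_cast; ring
  -- The two middle values are written as sums of length one, to be summed over `k` like the others.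
  have hS' : ∀ k, z * g k + x * alternateSum g n (k + 1) + y * alternateSum g n (k + 2) +
      x * (alternateSum g 1 (k + (2 * n + 1)) + alternateSum g 1 (k + (2 * n + 2))) +
      y * alternateSum g n (k + (2 * n + 3)) + x * alternateSum g n (k + (2 * n + 4)) =
      b + (a - b) * g k := fun k => by
    rw [← hS k, alternateSum_one, alternateSum_one]
    simp only [CycleType.word, weightedSum_append, weightedSum_wordPow_pair, weightedSum,
      List.length_append, length_wordPow, List.length_cons, List.length_nil]
    ring_nf
  obtain ⟨hC, hp3, h3⟩ := hg.periodic_three_of_local_relation (q := 2 * n + 2) (by omega)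
    (C := a - b - z + y) (D := y - x) (sub_ne_zero.2 hxy.symm) fun k => by
    have h1 := hS' k
    have h2 := hS' (k + 2)
    have e1 := alternateSum_add_two g n (k + 1)
    have e2 := alternateSum_add_two g n (k + 2)
    have e3 := alternateSum_add_two g n (k + (2 * n + 3))
    have e4 := alternateSum_add_two g n (k + (2 * n + 4))
    have p1 := hg.periodic k
    have p2 := hg.periodic (k + 1)
    rw [hn] at p1 p2
    rw [alternateSum_one, alternateSum_one] at h1 h2
    ring_nf at h1 h2 e1 e2 e3 e4 p1 p2 ⊢
    rw [e1, e2, e3, e4, p1, p2] at h2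
    linear_combination h1 - h2
  -- Summing `S k = b + (a - b) * g k` over all `k` determines `b`.
  have htot : (z + (2 * n + 2) * x + 2 * n * y) * ∑ k ∈ Finset.range p, g k =
      p * b + (a - b) * ∑ k ∈ Finset.range p, g k := by
    have := Finset.sum_congr (rfl : Finset.range p = _) fun k _ => hS' k
    simp only [Finset.sum_add_distrib, ← Finset.mul_sum,
      sum_alternateSum_of_periodic hg.periodic, Finset.sum_const, Finset.card_range,
      nsmul_eq_mul] at this
    push_cast at this
    linarith
  have hp0 : (p : ℝ) ≠ 0 := by rw [hpr]; positivity
  have hab : a = z - x + b := by linarith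
  refine ⟨hp3, ?_⟩
  have hb : ∀ r : ℝ, ∑ k ∈ Finset.range p, g k = r * p →
      b = r * ((p + 3) / 2 * x + (p - 3) / 2 * y) := fun r hr => by
    rw [hr, hab] at htot
    apply mul_left_cancel₀ hp0
    rw [hpr] at htot ⊢
    linear_combination -htot
  rcases hg.sum_eq_of_periodic_three hp3 h3 with hN | hN
  · right
    have := hb (1 / 3) (by rw [hN]; ring)
    constructor <;> linarith
  · left
    have := hb (2 / 3) (by rw [hN]; ring)
    constructor <;> linarith

/-- The equation `hS` says that the sum `S k` is `a` at the black vertices and `b` at the white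
ones; this is the form in which the constant 2-labelling enters. -/
theorem possibleConstants_of_word {T : CycleType} {x y z t a b : ℝ} {n : ℕ}
    (hg : IsBlackIndicator p g) (hlen : (T.word x y z t n).length = p)
    (hT : T.DistinctWeights x y t)
    (hS : ∀ k, weightedSum g (T.word x y z t n) k = b + (a - b) * g k) :
    PossibleConstants p x y z t a b T := by
  cases T <;>
    simp only [CycleType.word, List.length_append, length_wordPow, List.length_cons,
      List.length_nil] at hlen
  · exact hg.possibleConstants_type1 (by omega) hS
  · exact hg.possibleConstants_type2 (by omega) hT hS
  · exact hg.not_type3 (by omega) hT hS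
  · exact hg.possibleConstants_type4 (by omega) hT hS
  · exact hg.possibleConstants_type5 (by omega) hT hS
  · exact hg.possibleConstants_type6 (by omega) hT hS
  · exact hg.possibleConstants_type7 (by omega) hT.1 hT.2 hS
  · exact hg.possibleConstants_type8 (by omega) hT.1 hT.2 hS

end IsBlackIndicator

/-! ### From colorings to indicator functions -/

/-- The indicator function of the black vertices of a coloring of the cycle of length `p`, with the
vertices read modulo `p`. -/
noncomputable def blackIndicator (p : ℕ) [NeZero p] (φ : Fin p → Color) (k : ℕ) : ℝ :=
  if φ (Fin.ofNat p k) = Color.black then 1 else 0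

section Coloring

variable {p : ℕ} [NeZero p]

theorem blackIndicator_of_eq_black {φ : Fin p → Color} {k : ℕ}
    (h : φ (Fin.ofNat p k) = Color.black) : blackIndicator p φ k = 1 :=
  if_pos h

theorem blackIndicator_of_ne_black {φ : Fin p → Color} {k : ℕ}
    (h : φ (Fin.ofNat p k) ≠ Color.black) : blackIndicator p φ k = 0 :=
  if_neg h

theorem isBlackIndicator_blackIndicator {φ : Fin p → Color} (hφ : ¬ IsMonochromatic φ) :
    IsBlackIndicator p (blackIndicator p φ) := by
  have hex : ∀ c, ∃ k : ℕ, φ (Fin.ofNat p k) ≠ c := by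
    intro c
    by_contra! h
    exact hφ ⟨c, fun u => by rw [← h u, Fin.ofNat_val_eq_self]⟩
  refine ⟨fun k => ?_, fun k => ?_, ?_, ?_⟩
  · unfold blackIndicator
    split_ifs <;> simp
  · have : Fin.ofNat p (k + p) = Fin.ofNat p k := by ext; simp
    rw [blackIndicator, this, blackIndicator]
  · obtain ⟨k, hk⟩ := hex .white
    refine ⟨k, blackIndicator_of_eq_black ?_⟩
    cases h : φ (Fin.ofNat p k) with
    | black => rfl
    | white => exact absurd h hk
  · obtain ⟨k, hk⟩ := hex .black
    exact ⟨k, blackIndicator_of_ne_black hk⟩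

theorem apply_of_mem_cycleRotations {ξ : SimpleGraph.cycleGraph p ≃g SimpleGraph.cycleGraph p}
    (hξ : ξ ∈ cycleRotations p) (u : Fin p) : ξ u = Fin.ofNat p ((ξ 0 : ℕ) + u) := by
  obtain ⟨k, rfl⟩ := hξ
  change u + Fin.intCast k = Fin.ofNat p (((0 + Fin.intCast k : Fin p) : ℕ) + u)
  ext
  rw [zero_add, Fin.val_add]
  simp [add_comm]

theorem exists_mem_cycleRotations_apply_zero (v : Fin p) :
    ∃ ξ ∈ cycleRotations p, ξ 0 = v := by
  refine ⟨cycleRotation p (v : ℕ), ⟨_, rfl⟩, ?_⟩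
  have h := cycleRotation_val p (v : ℕ) 0
  have h' : ((0 : Fin p) : ℕ) = 0 := rfl
  rw [h', Nat.cast_zero, zero_add, Int.emod_eq_of_lt (by positivity) (by exact_mod_cast v.2)] at h
  ext
  exact_mod_cast h

theorem blackWeight_eq_weightedSum {ξ : SimpleGraph.cycleGraph p ≃g SimpleGraph.cycleGraph p}
    (hξ : ξ ∈ cycleRotations p) (w : Fin p → ℝ) (φ : Fin p → Color) :
    blackWeight w φ ξ = weightedSum (blackIndicator p φ) (List.ofFn w) (ξ 0 : ℕ) := by
  rw [weightedSum_ofFn, blackWeight, Finset.sum_filter]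
  refine Finset.sum_congr rfl fun u _ => ?_
  rw [apply_of_mem_cycleRotations hξ u, blackIndicator]
  split_ifs <;> simp

end Coloring

theorem mainTheorem1 (p : ℕ) [NeZero p] (hp : 2 ≤ p) (T : CycleType) (x y z t : ℝ)
    (w : Fin p → ℝ) (hw : IsCycleOfType T w x y z t) (φ : Fin p → Color)
    (hφ : IsConstantTwoLabelling (SimpleGraph.cycleGraph p) 0 w (cycleRotations p) φ)
    (hnontriv : ¬ IsMonochromatic φ) :
    (autsWithColor (SimpleGraph.cycleGraph p) 0 (cycleRotations p) φ Color.black).Nonempty ∧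
    (autsWithColor (SimpleGraph.cycleGraph p) 0 (cycleRotations p) φ Color.white).Nonempty ∧
    ∀ ξ ∈ autsWithColor (SimpleGraph.cycleGraph p) 0 (cycleRotations p) φ Color.black,
      ∀ ξ' ∈ autsWithColor (SimpleGraph.cycleGraph p) 0 (cycleRotations p) φ Color.white,
        PossibleConstants p x y z t (blackWeight w φ ξ) (blackWeight w φ ξ') T := by
  have hg := isBlackIndicator_blackIndicator hnontriv
  obtain ⟨⟨n, hword⟩, hT⟩ := hw
  refine ⟨?_, ?_, fun ξ hξ ξ' hξ' => ?_⟩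
  · obtain ⟨k, hk⟩ := hg.exists_black
    obtain ⟨ξ, hξ, h0⟩ := exists_mem_cycleRotations_apply_zero (Fin.ofNat p k)
    refine ⟨ξ, hξ, ?_⟩
    by_contra hne
    rw [h0] at hne
    rw [blackIndicator_of_ne_black hne] at hk
    exact zero_ne_one hk
  · obtain ⟨k, hk⟩ := hg.exists_white
    obtain ⟨ξ, hξ, h0⟩ := exists_mem_cycleRotations_apply_zero (Fin.ofNat p k)
    refine ⟨ξ, hξ, ?_⟩
    rw [h0]
    cases h : φ (Fin.ofNat p k) with
    | black => exact absurd ((blackIndicator_of_eq_black h).symm.trans hk) one_ne_zero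
    | white => rfl
  · have hlen : (T.word x y z t n).length = p := by rw [← hword, List.length_ofFn]
    refine hg.possibleConstants_of_word hlen hT fun k => ?_
    obtain ⟨η, hη, h0⟩ := exists_mem_cycleRotations_apply_zero (Fin.ofNat p k)
    have hηk : blackWeight w φ η = weightedSum (blackIndicator p φ) (List.ofFn w) k := by
      rw [blackWeight_eq_weightedSum hη, weightedSum_ofFn, weightedSum_ofFn, h0]
      refine Finset.sum_congr rfl fun i _ => ?_
      have : Fin.ofNat p ((Fin.ofNat p k : ℕ) + i) = Fin.ofNat p (k + i) := by ext; simp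
      rw [blackIndicator, this, blackIndicator]
    rw [← hword, ← hηk]
    cases h : φ (Fin.ofNat p k) with
    | black =>
      rw [hφ .black η ⟨hη, by rw [h0, h]⟩ ξ hξ, blackIndicator_of_eq_black h]
      ring
    | white =>
      rw [hφ .white η ⟨hη, by rw [h0, h]⟩ ξ' hξ',
        blackIndicator_of_ne_black (by rw [h]; exact Color.noConfusion)]
      ring
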